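/- Let $d_{\mathrm{out}}, d_{\mathrm{in}}, r \ge 1$ be integers. On real matrices of equal size put $\langle X, Y\rangle_F = \mathrm{tr}(X^\top Y)$, $\|X\|_F = \sqrt{\langle X, X\rangle_F}$ and $$\cos(X, Y) = \frac{\langle X, Y\rangle_F}{\|X\|_F\,\|Y\|_F},$$ with the convention $\cos(X,Y) = 0$ if $X = 0$ or $Y = 0$. Let $G \in \mathbb{R}^{d_{\mathrm{out}} \times d_{\mathrm{in}}}$ be a fixed nonzero matrix (the true gradient), let $A \in \mathbb{R}^{d_{\mathrm{in}} \times r}$ have orthonormal columns ($A^\top A = I_r$), and let $R \in \mathbb{R}^{d_{\mathrm{out}} \times r}$ be a random matrix with i.i.d. standard normal entries. Let $$\widehat{G}_0^{\mathrm{AGZO}} = \langle G, R A^\top\rangle_F\, R A^\top$$ be the noiseless AGZO (activation-guided zeroth-order) estimator of $G$. Then $\cos(\widehat{G}_0^{\mathrm{AGZO}}, G)$ is integrable and $$\mathbb{E}_R\big[\cos(\widehat{G}_0^{\mathrm{AGZO}}, G)\big] = \beta_{d_{\mathrm{out}} r}\, \frac{\|GA\|_F}{\|G\|_F}, \qquad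 \text{where } \beta_D = \frac{\Gamma(D/2)}{\sqrt{\pi}\,\Gamma((D+1)/2)} \text{ for integers } D \ge 1.$$ Moreover, for every integer $D \ge 2$, $$\sqrt{\frac{2}{\pi D}} \le \beta_D \le \sqrt{\frac{2}{\pi (D-1)}}.$$ -/

import Mathlib

open MeasureTheory ProbabilityTheory
open scoped Matrix

noncomputable section

/-- The Frobenius inner product `tr(Xᵀ Y)` of two real matrices. -/
def frobInner {m n : ℕ} (X Y : Matrix (Fin m) (Fin n) ℝ) : ℝ :=
  (Xᵀ * Y).trace

/-- The Frobenius norm of a real matrix. -/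
def frobNorm {m n : ℕ} (X : Matrix (Fin m) (Fin n) ℝ) : ℝ :=
  √(frobInner X X)

/-- Cosine similarity of two real matrices (it is `0` when one of them vanishes). -/
def cosSim {m n : ℕ} (X Y : Matrix (Fin m) (Fin n) ℝ) : ℝ :=
  frobInner X Y / (frobNorm X * frobNorm Y)

/-- The noiseless AGZO estimator `⟨G, Δ⟩ Δ` with the perturbation `Δ = R Aᵀ`. -/
def agzoEstimator {dout din r : ℕ} (G : Matrix (Fin dout) (Fin din) ℝ)
    (A : Matrix (Fin din) (Fin r) ℝ) (R : Matrix (Fin dout) (Fin r) ℝ) :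
    Matrix (Fin dout) (Fin din) ℝ :=
  frobInner G (R * Aᵀ) • (R * Aᵀ)

/-- `β_D = Γ(D/2) / (√π Γ((D+1)/2))`. -/
def agzoBeta (D : ℕ) : ℝ :=
  Real.Gamma ((D : ℝ) / 2) / (√Real.pi * Real.Gamma (((D : ℝ) + 1) / 2))

/-- A random real matrix whose entries are i.i.d. standard normal variables. -/
structure IsStdGaussianMatrix {Ω : Type*} [MeasurableSpace Ω] {m n : ℕ}
    (R : Ω → Matrix (Fin m) (Fin n) ℝ) (P : Measure Ω) : Prop where
  entry_law : ∀ i j, HasLaw (fun ω => R ω i j) (gaussianReal 0 1) P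
  indep : iIndepFun (fun (p : Fin m × Fin n) (ω : Ω) => R ω p.1 p.2) P

end

/-! Since `Aᵀ * A = 1`, multiplication by `Aᵀ` is an isometry with adjoint multiplication by `A`, so
the cosine equals `|⟨GA, R⟩| / (‖R‖ ‖G‖)` (`cosSim_agzoEstimator`). The entries of `R` form a
standard Gaussian vector `x` in dimension `D = dout * r`, and with `u = GA` it remains to find the
mean of `|⟨u, x⟩| / ‖x‖`. In polar coordinates this mean and that of `|⟨u, x⟩|` share the same
sphere integral and differ only in a radial moment. The second is `‖u‖ √(2/π)`, because `⟨u, x⟩` is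
a one-dimensional Gaussian; the quotient of the moments then gives `β_D`, and the sphere integral is
never computed. The bounds on `β_D` follow from log-convexity of `Γ`. -/

open Metric Set Module in
/-- Integration in polar coordinates of the product of an angular and a radial function. -/
theorem integral_angular_mul_radial {E : Type*} [NormedAddCommGroup E] [NormedSpace ℝ E]
    [FiniteDimensional ℝ E] [MeasurableSpace E] [BorelSpace E] [Nontrivial E]
    (μ : Measure E) [μ.IsAddHaarMeasure] (h : E → ℝ) (φ : ℝ → ℝ) :
    ∫ x, h (‖x‖⁻¹ • x) * φ ‖x‖ ∂μ
      = (∫ θ : sphere (0 : E) 1, h θ ∂μ.toSphere) *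
        ∫ t in Ioi (0 : ℝ), t ^ (finrank ℝ E - 1) * φ t :=
  calc
    ∫ x, h (‖x‖⁻¹ • x) * φ ‖x‖ ∂μ
      = ∫ x : ({(0)}ᶜ : Set E), h (‖x.1‖⁻¹ • x.1) * φ ‖x.1‖ ∂(μ.comap (↑)) := by
      rw [integral_subtype_comap (measurableSet_singleton _).compl
        fun x ↦ h (‖x‖⁻¹ • x) * φ ‖x‖, restrict_compl_singleton]
    _ = ∫ x : sphere (0 : E) 1 × Ioi (0 : ℝ), h x.1 * φ x.2
          ∂μ.toSphere.prod (.volumeIoiPow (finrank ℝ E - 1)) := by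
      simpa using μ.measurePreserving_homeomorphUnitSphereProd.integral_comp
        (Homeomorph.measurableEmbedding _)
        (fun x : sphere (0 : E) 1 × Ioi (0 : ℝ) ↦ h x.1 * φ x.2)
    -- This factorization needs no integrability, so none is assumed of `h` and `φ`.
    _ = (∫ θ : sphere (0 : E) 1, h θ ∂μ.toSphere) *
          ∫ t : Ioi (0 : ℝ), φ t ∂.volumeIoiPow (finrank ℝ E - 1) :=
      integral_prod_mul (fun θ : sphere (0 : E) 1 ↦ h θ) (fun t : Ioi (0 : ℝ) ↦ φ t)
    _ = _ := by
      congr 1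
      simp only [Measure.volumeIoiPow, ENNReal.ofReal]
      rw [integral_withDensity_eq_integral_smul,
        integral_subtype_comap measurableSet_Ioi
          fun a ↦ Real.toNNReal (a ^ (finrank ℝ E - 1)) • φ a,
        setIntegral_congr_fun measurableSet_Ioi fun x hx ↦ ?_]
      · rw [NNReal.smul_def, Real.coe_toNNReal _ (pow_nonneg hx.out.le _), smul_eq_mul]
      · exact (measurable_subtype_coe.pow_const _).real_toNNReal

section StdGaussian

variable {E : Type*} [NormedAddCommGroup E] [InnerProductSpace ℝ E] [FiniteDimensional ℝ E]
  [MeasurableSpace E] [BorelSpace E]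

open Module

/-- The Gaussian weight has the expected total mass. -/
theorem integral_exp_neg_sq_norm_div_two :
    ∫ x : E, Real.exp (-(‖x‖ ^ 2 / 2)) = (2 * Real.pi) ^ (finrank ℝ E / 2 : ℝ) := by
  have := GaussianFourier.integral_rexp_neg_mul_sq_norm (V := E) (b := 1 / 2) (by norm_num)
  rw [show Real.pi / (1 / 2) = 2 * Real.pi by ring] at this
  rw [← this]
  congr 1 with x
  ring_nf

/-- A non-integrable function has Bochner integral `0`, but the value here is positive. -/
theorem integrable_exp_neg_sq_norm_div_two :
    Integrable (fun x : E ↦ Real.exp (-(‖x‖ ^ 2 / 2))) := by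
  by_contra h
  have h0 := integral_exp_neg_sq_norm_div_two (E := E)
  rw [integral_undef h] at h0
  exact absurd h0.symm (by positivity)

/-- The density of the standard Gaussian measure with respect to the volume. -/
theorem stdGaussian_eq_withDensity :
    stdGaussian E = volume.withDensity (fun x ↦ ((Real.toNNReal
      (((2 * Real.pi) ^ (finrank ℝ E / 2 : ℝ))⁻¹ * Real.exp (-(‖x‖ ^ 2 / 2))) : NNReal) :
        ENNReal)) := by
  -- Characteristic functions determine finite measures only.
  have : IsFiniteMeasure (volume.withDensity (fun x : E ↦ ((Real.toNNReal
      (((2 * Real.pi) ^ (finrank ℝ E / 2 : ℝ))⁻¹ * Real.exp (-(‖x‖ ^ 2 / 2))) : NNReal) :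
        ENNReal))) :=
    isFiniteMeasure_withDensity_ofReal
      (integrable_exp_neg_sq_norm_div_two.const_mul _).hasFiniteIntegral
  refine Measure.ext_of_charFun (funext fun t ↦ ?_)
  rw [charFun_stdGaussian, charFun_apply, integral_withDensity_eq_integral_smul (by fun_prop)]
  have key := GaussianFourier.integral_cexp_neg_mul_sq_norm_add (V := E) (b := 1 / 2)
    (by norm_num) Complex.I t
  have hpi : (0 : ℝ) ≤ 2 * Real.pi := by positivity
  have hc : ((Real.pi : ℂ) / (1 / 2)) ^ (finrank ℝ E / 2 : ℂ)
      = (((2 * Real.pi) ^ (finrank ℝ E / 2 : ℝ) : ℝ) : ℂ) := by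
    rw [Complex.ofReal_cpow hpi]
    push_cast
    congr 1
    ring
  have hne : (((2 * Real.pi) ^ (finrank ℝ E / 2 : ℝ) : ℝ) : ℂ) ≠ 0 := by
    exact_mod_cast (by positivity : ((2 * Real.pi) ^ (finrank ℝ E / 2 : ℝ) : ℝ) ≠ 0)
  rw [hc] at key
  have hcongr : ∀ x : E, (Real.toNNReal
      (((2 * Real.pi) ^ (finrank ℝ E / 2 : ℝ))⁻¹ * Real.exp (-(‖x‖ ^ 2 / 2)))) •
        Complex.exp (inner ℝ x t * Complex.I)
      = (((2 * Real.pi) ^ (finrank ℝ E / 2 : ℝ) : ℝ) : ℂ)⁻¹ *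
        Complex.exp (-(1 / 2) * ‖x‖ ^ 2 + Complex.I * inner ℝ t x) := by
    intro x
    rw [NNReal.smul_def, Real.coe_toNNReal _ (by positivity), Complex.real_smul,
      Complex.exp_add, real_inner_comm]
    push_cast
    rw [mul_assoc]
    ring_nf
  simp_rw [hcongr]
  rw [integral_const_mul, key, inv_mul_cancel_left₀ hne]
  congr 1
  rw [Complex.I_sq]
  ring

theorem integral_stdGaussian (f : E → ℝ) :
    ∫ x, f x ∂stdGaussian E = ((2 * Real.pi) ^ (finrank ℝ E / 2 : ℝ))⁻¹ *
      ∫ x, f x * Real.exp (-(‖x‖ ^ 2 / 2)) := by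
  rw [stdGaussian_eq_withDensity, integral_withDensity_eq_integral_smul (by fun_prop),
    ← integral_const_mul]
  congr 1 with x
  rw [NNReal.smul_def, Real.coe_toNNReal _ (by positivity), smul_eq_mul]
  ring

/-- The moments of the Gaussian weight on the half-line. -/
theorem integral_pow_mul_exp_neg_sq_div_two (n : ℕ) :
    ∫ t in Set.Ioi (0 : ℝ), t ^ n * Real.exp (-(t ^ 2 / 2))
      = 2 ^ (((n : ℝ) + 1) / 2) * (1 / 2) * Real.Gamma (((n : ℝ) + 1) / 2) := by
  have := integral_rpow_mul_exp_neg_mul_rpow (p := 2) (q := n) (b := 1 / 2) (by norm_num)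
    (by linarith [n.cast_nonneg (α := ℝ)]) (by norm_num)
  rw [neg_div, Real.rpow_neg (by norm_num), ← Real.inv_rpow (by norm_num)] at this
  norm_num at this ⊢
  rw [← this]
  congr 1 with t
  ring_nf

theorem integral_abs_gaussianReal :
    ∫ x, |x| ∂gaussianReal 0 1 = √(2 / Real.pi) := by
  have hJ := integral_pow_mul_exp_neg_sq_div_two 1
  have habs := integral_comp_abs (f := fun t : ℝ ↦ t ^ 1 * Real.exp (-(t ^ 2 / 2)))
  rw [hJ] at habs
  norm_num at habs
  rw [integral_gaussianReal_eq_integral_smul one_ne_zero]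
  have hcongr : ∀ x : ℝ, gaussianPDFReal 0 1 x • |x|
      = (√(2 * Real.pi))⁻¹ * (|x| * Real.exp (-(x ^ 2 / 2))) := by
    intro x
    simp only [gaussianPDFReal, NNReal.coe_one, mul_one, sub_zero, smul_eq_mul, neg_div]
    ring
  simp_rw [hcongr]
  rw [integral_const_mul, habs, Real.sqrt_mul (by norm_num), Real.sqrt_div (by norm_num)]
  have : √2 * √2 = (2 : ℝ) := Real.mul_self_sqrt (by norm_num)
  have h2 : √(2 : ℝ) ≠ 0 := by positivity
  have h3 : √Real.pi ≠ 0 := by positivity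
  field_simp
  linarith

/-- The law of a linear functional under the standard Gaussian measure. -/
theorem stdGaussian_map_inner (u : E) :
    (stdGaussian E).map (fun x ↦ inner ℝ u x) = (gaussianReal 0 1).map (‖u‖ * ·) := by
  have h := IsGaussian.map_eq_gaussianReal (μ := stdGaussian E) (innerSL ℝ u)
  rw [integral_strongDual_stdGaussian, variance_dual_stdGaussian, innerSL_apply_norm] at h
  rw [gaussianReal_map_const_mul]
  convert h using 2
  · simp
  · simp
  · rw [mul_one, Real.toNNReal_of_nonneg (sq_nonneg _)]

theorem integral_abs_inner_stdGaussian (u : E) :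
    ∫ x, |inner ℝ u x| ∂stdGaussian E = ‖u‖ * √(2 / Real.pi) := by
  have h := integral_map (μ := stdGaussian E) (φ := fun x ↦ inner ℝ u x) (f := fun y : ℝ ↦ |y|)
    (by fun_prop) (by fun_prop)
  rw [← h, stdGaussian_map_inner, integral_map (by fun_prop) (by fun_prop)]
  simp_rw [abs_mul, abs_norm]
  rw [integral_const_mul, integral_abs_gaussianReal]

/-- The mean absolute projection of a uniformly random direction on a fixed vector. -/
theorem integral_abs_inner_div_norm_stdGaussian [Nontrivial E] (u : E) :
    ∫ x, |inner ℝ u x| / ‖x‖ ∂stdGaussian E = agzoBeta (finrank ℝ E) * ‖u‖ := by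
  have hD : 0 < finrank ℝ E := finrank_pos
  have h2 := integral_abs_inner_stdGaussian u
  rw [integral_stdGaussian] at h2 ⊢
  have e1 : ∀ x : E, |inner ℝ u x| / ‖x‖ * Real.exp (-(‖x‖ ^ 2 / 2))
      = |inner ℝ u (‖x‖⁻¹ • x)| * Real.exp (-(‖x‖ ^ 2 / 2)) := by
    intro x
    rw [inner_smul_right, abs_mul, abs_inv, abs_norm]
    ring
  have e2 : ∀ x : E, |inner ℝ u x| * Real.exp (-(‖x‖ ^ 2 / 2))
      = |inner ℝ u (‖x‖⁻¹ • x)| * (‖x‖ * Real.exp (-(‖x‖ ^ 2 / 2))) := by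
    intro x
    rcases eq_or_ne x 0 with rfl | hx
    · simp
    · have : ‖x‖ ≠ 0 := norm_ne_zero_iff.2 hx
      rw [inner_smul_right, abs_mul, abs_inv, abs_norm]
      field_simp
  simp_rw [e1]
  simp_rw [e2] at h2
  rw [integral_angular_mul_radial volume (fun x : E ↦ |inner ℝ u x|)
    (fun t ↦ Real.exp (-(t ^ 2 / 2))), integral_pow_mul_exp_neg_sq_div_two]
  rw [integral_angular_mul_radial volume (fun x : E ↦ |inner ℝ u x|)
    (fun t ↦ t * Real.exp (-(t ^ 2 / 2)))] at h2
  simp_rw [← mul_assoc, pow_sub_one_mul hD.ne'] at h2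
  rw [integral_pow_mul_exp_neg_sq_div_two] at h2
  -- The unknown sphere integral `S` is eliminated between `h2` and the goal.
  generalize (∫ θ : Metric.sphere (0 : E) 1, |inner ℝ u θ.1| ∂volume.toSphere) = S at h2 ⊢
  have hcast : ((finrank ℝ E - 1 : ℕ) : ℝ) + 1 = finrank ℝ E := by
    rw [Nat.cast_pred hD]; ring
  rw [hcast]
  have hDr : (0 : ℝ) < finrank ℝ E := by exact_mod_cast hD
  unfold agzoBeta
  generalize (finrank ℝ E : ℝ) = d at h2 hDr ⊢
  have hΓ : Real.Gamma ((d + 1) / 2) ≠ 0 := (Real.Gamma_pos_of_pos (by positivity)).ne'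
  have hpow : (2 : ℝ) ^ ((d + 1) / 2) = 2 ^ (d / 2) * √2 := by
    rw [add_div, Real.rpow_add (by norm_num), Real.sqrt_eq_rpow]
  have h3 : √Real.pi ≠ 0 := by positivity
  have h4 : √(2 : ℝ) ≠ 0 := by positivity
  rw [hpow, Real.sqrt_div (by norm_num)] at h2
  generalize (2 : ℝ) ^ (d / 2) = q at h2 ⊢
  generalize ((2 * Real.pi) ^ (d / 2))⁻¹ = c at h2 ⊢
  have h5 : c * S * q * (1 / 2) * Real.Gamma ((d + 1) / 2) * √Real.pi = ‖u‖ := by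
    field_simp at h2 ⊢
    linarith
  rw [← h5]
  field_simp

end StdGaussian

/-- Log-convexity of `Γ` at the midpoint of `x` and `x + 1`, with `Γ(x + 1) = x Γ(x)`. -/
theorem Real.Gamma_add_half_sq_le {x : ℝ} (hx : 0 < x) :
    Real.Gamma (x + 1 / 2) ^ 2 ≤ x * Real.Gamma x ^ 2 := by
  have h := Real.Gamma_mul_add_mul_le_rpow_Gamma_mul_rpow_Gamma hx (t := x + 1) (by linarith)
    (a := 1 / 2) (b := 1 / 2) (by norm_num) (by norm_num) (by norm_num)
  rw [← Real.sqrt_eq_rpow, ← Real.sqrt_eq_rpow, Real.Gamma_add_one hx.ne',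
    show 1 / 2 * x + 1 / 2 * (x + 1) = x + 1 / 2 by ring] at h
  have hG := Real.Gamma_pos_of_pos hx
  calc Real.Gamma (x + 1 / 2) ^ 2 ≤ (√(Real.Gamma x) * √(x * Real.Gamma x)) ^ 2 :=
        pow_le_pow_left₀ (Real.Gamma_pos_of_pos (by linarith)).le h 2
    _ = x * Real.Gamma x ^ 2 := by
        rw [mul_pow, Real.sq_sqrt hG.le, Real.sq_sqrt (by positivity)]
        ring

theorem sqrt_le_agzoBeta {D : ℕ} (hD : 1 ≤ D) : √(2 / (Real.pi * D)) ≤ agzoBeta D := by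
  have hd : (0 : ℝ) < D := by exact_mod_cast hD
  have h := Real.Gamma_add_half_sq_le (x := (D : ℝ) / 2) (by positivity)
  have h1 : 0 < Real.Gamma ((D : ℝ) / 2) := Real.Gamma_pos_of_pos (by positivity)
  have h2 : 0 < Real.Gamma (((D : ℝ) + 1) / 2) := Real.Gamma_pos_of_pos (by positivity)
  rw [show (D : ℝ) / 2 + 1 / 2 = (D + 1) / 2 by ring] at h
  unfold agzoBeta
  refine Real.sqrt_le_iff.2 ⟨by positivity, ?_⟩
  rw [div_pow, mul_pow, Real.sq_sqrt Real.pi_pos.le, div_le_div_iff₀ (by positivity)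
    (by positivity)]
  nlinarith [mul_le_mul_of_nonneg_left h Real.pi_pos.le]

theorem agzoBeta_le_sqrt {D : ℕ} (hD : 2 ≤ D) :
    agzoBeta D ≤ √(2 / (Real.pi * ((D : ℝ) - 1))) := by
  have hd : (2 : ℝ) ≤ D := by exact_mod_cast hD
  have hd1 : (0 : ℝ) < D - 1 := by linarith
  -- Half a step below the `D / 2` of the lower bound, which puts `Γ(D / 2)` on the small side.
  have h := Real.Gamma_add_half_sq_le (x := ((D : ℝ) - 1) / 2) (by positivity)
  have h1 : 0 < Real.Gamma ((D : ℝ) / 2) := Real.Gamma_pos_of_pos (by positivity)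
  have h2 : 0 < Real.Gamma (((D : ℝ) - 1) / 2) := Real.Gamma_pos_of_pos (by positivity)
  have h3 : Real.Gamma (((D : ℝ) + 1) / 2) = ((D : ℝ) - 1) / 2 * Real.Gamma (((D : ℝ) - 1) / 2) := by
    rw [← Real.Gamma_add_one (by positivity)]
    ring_nf
  rw [show ((D : ℝ) - 1) / 2 + 1 / 2 = D / 2 by ring] at h
  unfold agzoBeta
  refine Real.le_sqrt_of_sq_le ?_
  rw [h3, div_pow, mul_pow, Real.sq_sqrt Real.pi_pos.le, div_le_div_iff₀ (by positivity)
    (by positivity)]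
  calc _ ≤ (((D : ℝ) - 1) / 2 * Real.Gamma (((D : ℝ) - 1) / 2) ^ 2) * (Real.pi * (D - 1)) := by
        gcongr
    _ = _ := by ring

section Frobenius

variable {m n k : ℕ}

/-- The entries of a matrix as a vector of a Euclidean space. -/
def matrixVec (X : Matrix (Fin m) (Fin n) ℝ) : EuclideanSpace ℝ (Fin m × Fin n) :=
  WithLp.toLp 2 fun p ↦ X p.1 p.2

theorem frobInner_eq_inner (X Y : Matrix (Fin m) (Fin n) ℝ) :
    frobInner X Y = inner ℝ (matrixVec X) (matrixVec Y) := by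
  simp only [frobInner, Matrix.trace, Matrix.diag_apply, Matrix.mul_apply, Matrix.transpose_apply,
    matrixVec, PiLp.inner_apply, Fintype.sum_prod_type]
  rw [Finset.sum_comm]
  simp [mul_comm]

theorem frobNorm_eq_norm (X : Matrix (Fin m) (Fin n) ℝ) : frobNorm X = ‖matrixVec X‖ := by
  rw [frobNorm, frobInner_eq_inner, real_inner_self_eq_norm_sq, Real.sqrt_sq (norm_nonneg _)]

theorem frobInner_smul_left (c : ℝ) (X Y : Matrix (Fin m) (Fin n) ℝ) :
    frobInner (c • X) Y = c * frobInner X Y := by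
  simp [frobInner]

theorem frobInner_comm (X Y : Matrix (Fin m) (Fin n) ℝ) : frobInner X Y = frobInner Y X := by
  rw [frobInner_eq_inner, frobInner_eq_inner, real_inner_comm]

theorem frobNorm_smul (c : ℝ) (X : Matrix (Fin m) (Fin n) ℝ) :
    frobNorm (c • X) = |c| * frobNorm X := by
  rw [frobNorm, frobInner_smul_left, frobInner_comm, frobInner_smul_left, ← mul_assoc,
    Real.sqrt_mul (mul_self_nonneg c), Real.sqrt_mul_self_eq_abs, frobNorm]

theorem frobInner_mul_transpose (G : Matrix (Fin m) (Fin n) ℝ) (A : Matrix (Fin n) (Fin k) ℝ)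
    (S : Matrix (Fin m) (Fin k) ℝ) : frobInner G (S * Aᵀ) = frobInner (G * A) S := by
  rw [frobInner, frobInner, Matrix.transpose_mul, ← Matrix.mul_assoc, Matrix.trace_mul_comm,
    Matrix.mul_assoc]

theorem frobNorm_mul_transpose {A : Matrix (Fin n) (Fin k) ℝ} (hA : Aᵀ * A = 1)
    (S : Matrix (Fin m) (Fin k) ℝ) : frobNorm (S * Aᵀ) = frobNorm S := by
  rw [frobNorm, frobNorm, frobInner_mul_transpose, Matrix.mul_assoc, hA, Matrix.mul_one]

/-- The cosine similarity of the estimator is the normalized absolute projection of the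
perturbation on `G * A`. -/
theorem cosSim_agzoEstimator (G : Matrix (Fin m) (Fin n) ℝ) {A : Matrix (Fin n) (Fin k) ℝ}
    (hA : Aᵀ * A = 1) (S : Matrix (Fin m) (Fin k) ℝ) :
    cosSim (agzoEstimator G A S) G
      = |inner ℝ (matrixVec (G * A)) (matrixVec S)| / ‖matrixVec S‖ / frobNorm G := by
  rw [cosSim, agzoEstimator, frobInner_smul_left, frobNorm_smul, frobNorm_mul_transpose hA,
    frobInner_comm _ G, frobInner_mul_transpose, ← frobInner_eq_inner, ← frobNorm_eq_norm]
  generalize frobInner (G * A) S = c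
  -- If `c = 0`, both sides are `0`, also when `S = 0`; otherwise a factor `|c|` cancels.
  rcases eq_or_ne c 0 with rfl | hc
  · simp
  · rw [← abs_mul_abs_self c, mul_assoc, mul_div_mul_left _ _ (abs_ne_zero.2 hc), div_div]

theorem frobNorm_pos {G : Matrix (Fin m) (Fin n) ℝ} (hG : G ≠ 0) : 0 < frobNorm G := by
  rw [frobNorm_eq_norm, norm_pos_iff]
  contrapose! hG
  ext i j
  exact congrArg (fun v : EuclideanSpace ℝ (Fin m × Fin n) ↦ v (i, j)) hG

theorem IsStdGaussianMatrix.hasLaw_matrixVec {Ω : Type*} [MeasurableSpace Ω] {P : Measure Ω}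
    [IsProbabilityMeasure P] {R : Ω → Matrix (Fin m) (Fin n) ℝ} (hR : IsStdGaussianMatrix R P) :
    HasLaw (fun ω ↦ matrixVec (R ω)) (stdGaussian (EuclideanSpace ℝ (Fin m × Fin n))) P := by
  have hmeas : ∀ p : Fin m × Fin n, AEMeasurable (fun ω ↦ R ω p.1 p.2) P :=
    fun p ↦ (hR.entry_law p.1 p.2).aemeasurable
  have hlaw : HasLaw (fun ω (p : Fin m × Fin n) ↦ R ω p.1 p.2)
      (Measure.pi fun _ ↦ gaussianReal 0 1) P := by
    refine ⟨aemeasurable_pi_lambda _ hmeas, ?_⟩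
    rw [(iIndepFun_iff_map_fun_eq_pi_map hmeas).1 hR.indep]
    congr with p : 1
    exact (hR.entry_law p.1 p.2).map_eq
  have hvec : HasLaw (WithLp.toLp 2 : (Fin m × Fin n → ℝ) → EuclideanSpace ℝ (Fin m × Fin n))
      (stdGaussian _) (Measure.pi fun _ ↦ gaussianReal 0 1) :=
    ⟨by fun_prop, map_pi_eq_stdGaussian⟩
  exact hvec.fun_comp hlaw

end Frobenius

theorem theorem2 {dout din r : ℕ} (hr : 1 ≤ r)
    (G : Matrix (Fin dout) (Fin din) ℝ) (hG : G ≠ 0)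
    (A : Matrix (Fin din) (Fin r) ℝ) (hA : Aᵀ * A = 1)
    {Ω : Type*} [MeasurableSpace Ω] (P : Measure Ω) [IsProbabilityMeasure P]
    (R : Ω → Matrix (Fin dout) (Fin r) ℝ) (hR : IsStdGaussianMatrix R P) :
    (Integrable (fun ω => cosSim (agzoEstimator G A (R ω)) G) P ∧
      ∫ ω, cosSim (agzoEstimator G A (R ω)) G ∂P
        = agzoBeta (dout * r) * (frobNorm (G * A) / frobNorm G)) ∧
    ∀ D : ℕ, 2 ≤ D →
      √(2 / (Real.pi * D)) ≤ agzoBeta D ∧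
        agzoBeta D ≤ √(2 / (Real.pi * ((D : ℝ) - 1))) := by
  have hlaw := hR.hasLaw_matrixVec
  have hdout : 1 ≤ dout := by
    rcases Nat.eq_zero_or_pos dout with rfl | h
    · exact absurd (Subsingleton.elim G 0) hG
    · exact h
  -- Makes the Euclidean space nontrivial, as the polar-coordinate formula requires.
  have : Nonempty (Fin dout × Fin r) := ⟨⟨0, hdout⟩, ⟨0, hr⟩⟩
  set u := matrixVec (G * A)
  have hf : Measurable fun x : EuclideanSpace ℝ (Fin dout × Fin r) ↦
      |inner ℝ u x| / ‖x‖ := by fun_prop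
  simp_rw [cosSim_agzoEstimator G hA]
  refine ⟨⟨?_, ?_⟩, fun D hD ↦ ⟨sqrt_le_agzoBeta (by omega), agzoBeta_le_sqrt hD⟩⟩
  -- By Cauchy–Schwarz the projection is bounded by `‖u‖`.
  · refine Integrable.div_const (Integrable.of_bound (C := ‖u‖)
      (hf.comp_aemeasurable hlaw.aemeasurable).aestronglyMeasurable (.of_forall fun ω ↦ ?_)) _
    rw [Function.comp_apply, Real.norm_eq_abs, abs_div, abs_abs, abs_norm]
    exact div_le_of_le_mul₀ (norm_nonneg _) (norm_nonneg _) (abs_real_inner_le_norm _ _)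
  · rw [integral_div, frobNorm_eq_norm (G * A), ← mul_div_assoc]
    have h := hlaw.integral_comp hf.aestronglyMeasurable
    rw [integral_abs_inner_div_norm_stdGaussian, finrank_euclideanSpace, Fintype.card_prod,
      Fintype.card_fin, Fintype.card_fin] at h
    rw [← h]
    rfl
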